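/- **Model.** Let $\Gamma$ be a finite set and $\Sigma$ a set with a group operation $\oplus$ (for instance $\{0,1\}$ with exclusive or). A nonadaptive quantum algorithm that makes $T$ queries to a black box $x:\Gamma\to\Sigma$ is given by two unitary operators $U,V$ on the Hilbert space with orthonormal basis $|i_1,\dots,i_T\rangle|\varphi_1,\dots,\varphi_T\rangle|\psi\rangle$, where $i_k\in\Gamma$, $\varphi_k\in\Sigma$ and $\psi$ ranges over the basis of a finite-dimensional workspace. With $$O_x^T|i_1,\dots,i_T\rangle|\varphi_1,\dots,\varphi_T\rangle|\psi\rangle=|i_1,\dots,i_T\rangle|\varphi_1\oplus x(i_1),\dots,\varphi_T\oplus x(i_T)\rangle|\psi\rangle ,$$ it computes the state $VO_x^TU|0\rangle$, where $|0\rangle$ is a fixed basis state, and its output is a function of the result of a measurement in the above basis. For a (possibly partial) function $F$ on $\Sigma^\Gamma$, the nonadaptive query complexity $Q^{na}_{2,\varepsilon}(F)$ is the smallest $T$ for which some such algorithm outputs $F(x)$ with probability at least $1-\varepsilon$ for every $x$ in the domain of $F$. Put $C_\varepsilon=(1-2\sqrt{\varepsilon(1-\varepsilon)})/2$. **Theorem.**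 Let $0\le\varepsilon<\frac12$. (a) Let $F:\Sigma^\Gamma\to\{0,1\}$ be a (possibly partial) function, let $X\subseteq F^{-1}(0)$ and $Y\subseteq F^{-1}(1)$ be nonempty, and let $m,m',l,l'$ be natural numbers and $R\subseteq X\times Y$ a relation such that * for every $x\in X$ there are at least $m$ elements $y\in Y$ with $(x,y)\in R$; * for every $y\in Y$ there are at least $m'$ elements $x\in X$ with $(x,y)\in R$; * for every $x\in X$ and $i\in\Gamma$ there are at most $l$ elements $y\in Y$ with $(x,y)\in R$ and $x(i)\ne y(i)$; * for every $y\in Y$ and $i\in\Gamma$ there are at most $l'$ elements $x\in X$ with $(x,y)\in R$ and $x(i)\ne y(i)$. Then $$Q^{na}_{2,\varepsilon}(F)\ \ge\ C_\varepsilon^2\,\max\Big(\frac{m}{l},\frac{m'}{l'}\Big),$$ where $0/0$ is read as $0$ (a zero denominator can occur only with a zero numerator). (b) $C_\varepsilon>0$, and the following bounds, both $\Omega(N)$, hold. * Unordered Search: for every $N\geq 0$, the function $\mathrm{OR}:\{0,1\}^N\to\{0,1\}$ satisfies $Q^{na}_{2,\varepsilon}(\mathrm{OR})\ge C_\varepsilon^2N$.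 * Element Distinctness: for every $N\ge2$ and every group $\Sigma$ in which the set $[N]$ of values is embedded, the function defined on the $x:[N]\to[N]\subseteq\Sigma$, with value $0$ if $x$ is one-to-one and $1$ otherwise, has $Q^{na}_{2,\varepsilon}\ge C_\varepsilon^2N$. -/

import Mathlib

open scoped ENNReal

noncomputable section

namespace NonadaptiveQuery

universe u v w

/-- The Hilbert space with orthonormal basis `|b⟩`, `b : ι`. If `ι` is finite, this is `ℂ^ι` with
its usual inner product. -/
abbrev Hilb (ι : Type u) : Type u := lp (fun _ : ι => ℂ) 2

theorem memlp_comp {ι : Type u} (e : ι ≃ ι) (f : Hilb ι) :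
    Memℓp (fun i => f (e i)) 2 := by
  have h := (memℓp_gen_iff (p := 2) (by norm_num)).1 (lp.memℓp f)
  exact (memℓp_gen_iff (p := 2) (by norm_num)).2 ((Equiv.summable_iff e).2 h)

/-- The unitary operator that permutes the basis vectors: `|b⟩ ↦ |e b⟩`. -/
def permUnitary {ι : Type u} (e : ι ≃ ι) : Hilb ι ≃ₗᵢ[ℂ] Hilb ι where
  toFun f := ⟨fun i => f (e.symm i), memlp_comp e.symm f⟩
  invFun f := ⟨fun i => f (e i), memlp_comp e f⟩
  left_inv f := by ext i; simp
  right_inv f := by ext i; simp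
  map_add' f g := by ext i; rfl
  map_smul' c f := by ext i; rfl
  norm_map' f := by
    rw [lp.norm_eq_tsum_rpow (p := 2) (by norm_num), lp.norm_eq_tsum_rpow (p := 2) (by norm_num)]
    congr 1
    exact Equiv.tsum_eq e.symm (fun i => ‖f i‖ ^ (2 : ℝ≥0∞).toReal)

/-- The basis state `|b⟩`. -/
def ket {ι : Type u} (b : ι) : Hilb ι :=
  letI := Classical.decEq ι
  lp.single 2 b (1 : ℂ)

theorem permUnitary_ket {ι : Type u} (e : ι ≃ ι) (b : ι) :
    permUnitary e (ket b) = ket (e b) := by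
  classical
  ext i
  change ket b (e.symm i) = ket (e b) i
  simp only [ket, lp.single_apply, Pi.single_apply, Equiv.symm_apply_eq]

/-- Labels `|i₁, …, i_T⟩ |φ₁, …, φ_T⟩ |ψ⟩` of the basis states of an algorithm that makes `T`
queries to a black box `Γ → A` and has a workspace of dimension `d`. -/
abbrev Basis (Γ : Type u) (A : Type v) (T d : ℕ) : Type (max u v) :=
  (Fin T → Γ) × (Fin T → A) × Fin d

/-- The permutation
`(i₁, …, i_T, φ₁, …, φ_T, ψ) ↦ (i₁, …, i_T, φ₁ + x(i₁), …, φ_T + x(i_T), ψ)`. -/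
def oraclePerm {Γ : Type u} {A : Type v} [AddGroup A] (T d : ℕ) (x : Γ → A) :
    Basis Γ A T d ≃ Basis Γ A T d where
  toFun b := (b.1, fun k => b.2.1 k + x (b.1 k), b.2.2)
  invFun b := (b.1, fun k => b.2.1 k - x (b.1 k), b.2.2)
  left_inv b := by simp
  right_inv b := by simp

/-- The call `O_x^T` to the black box `x`: `T` queries made simultaneously. -/
def oracle {Γ : Type u} {A : Type v} [AddGroup A] (T d : ℕ) (x : Γ → A) :
    Hilb (Basis Γ A T d) ≃ₗᵢ[ℂ] Hilb (Basis Γ A T d) :=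
  permUnitary (oraclePerm T d x)

/-- A nonadaptive quantum algorithm that makes `T` queries to a black box `Γ → A` and has outputs
in `S'`: a pair of unitary operators `(U, V)` on a space with a workspace of finite dimension
`work`, together with the name `start` of the initial basis state `|0⟩`, and the final measurement,
which returns `out b` when the basis state `b` is observed. -/
structure Algorithm (Γ : Type u) (A : Type v) (S' : Type w) (T : ℕ) where
  work : ℕ
  start : Basis Γ A T work
  U : Hilb (Basis Γ A T work) ≃ₗᵢ[ℂ] Hilb (Basis Γ A T work)
  V : Hilb (Basis Γ A T work) ≃ₗᵢ[ℂ] Hilb (Basis Γ A T work)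
  out : Basis Γ A T work → S'

namespace Algorithm

variable {Γ : Type u} {A : Type v} [AddGroup A] {S' : Type w} {T : ℕ}

/-- The final state `V O_x^T U |0⟩`. -/
def finalState (alg : Algorithm Γ A S' T) (x : Γ → A) : Hilb (Basis Γ A T alg.work) :=
  alg.V (oracle T alg.work x (alg.U (ket alg.start)))

/-- The probability that the outcome of the computation on the black box `x` is `s`. -/
def outcomeProb (alg : Algorithm Γ A S' T) (x : Γ → A) (s : S') : ℝ :=
  ∑' b : {b : Basis Γ A T alg.work // alg.out b = s}, ‖alg.finalState x b.1‖ ^ 2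

/-- The algorithm computes the partial function `F` with probability of error at most `ε`: this is
required of every black box in the domain of `F`. -/
def Computes (alg : Algorithm Γ A S' T) (F : (Γ → A) →. S') (ε : ℝ) : Prop :=
  ∀ x : Γ → A, ∀ s ∈ F x, 1 - ε ≤ alg.outcomeProb x s

end Algorithm

/-- The nonadaptive quantum query complexity of the partial function `F`: the smallest number of
queries of a nonadaptive quantum algorithm that computes `F` with probability of error at
most `ε` (`⊤` if there were none). -/
def queryComplexity {Γ : Type u} {A : Type v} [AddGroup A] {S' : Type w}
    (ε : ℝ) (F : (Γ → A) →. S') : ℕ∞ :=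
  ⨅ (T : ℕ) (_ : ∃ alg : Algorithm Γ A S' T, alg.Computes F ε), (T : ℕ∞)

/-- `C_ε = (1 - 2 √(ε (1 - ε))) / 2`. -/
def adversaryConst (ε : ℝ) : ℝ := (1 - 2 * √(ε * (1 - ε))) / 2

open scoped Classical in
/-- Unordered Search: the OR function on `{0, 1}^N`; addition in `ZMod 2` is exclusive or. -/
def unorderedSearch (N : ℕ) (x : Fin N → ZMod 2) : Fin 2 :=
  if ∃ i, x i = 1 then 1 else 0

open scoped Classical in
/-- Element Distinctness for functions from an `N`-element set to the set `D` of values: the value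
is `0` on one-to-one functions and `1` on the others. The answer registers are indexed by an
additive group `A` in which the set `D` of values is embedded. -/
def elementDistinctness {A : Type v} (N : ℕ) (D : Set A) : (Fin N → A) →. Fin 2 :=
  fun x => ⟨∀ i, x i ∈ D, fun _ => if Function.Injective x then 0 else 1⟩

end NonadaptiveQuery

end

/-! Nonadaptivity makes the state `U|0⟩` before the oracle call independent of the black box. If an
algorithm separates `x` from `y`, the final states are far apart, so `U|0⟩` has mass at least `C_ε`
on the labels whose queries tell `x` from `y` (`Computes.adversaryConst_le_mass`). Fix one `x` and
sum over `m` adversaries `y`: a label holds `T` queries, each telling `x` from at most `l` of them,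
so the masses add up to at most `T * l` (`sum_mass_le`). Hence `C_ε * m ≤ T * l`, and exchanging the
roles of `x` and `y` gives the bound with `m'` and `l'`. Both applications use inputs that differ
from a fixed one in a single place, with `m = N` and `l = 1`. -/

namespace NonadaptiveQuery

/-! ### Mass of a vector on a set of basis labels. -/

section HilbertSpace

variable {ι : Type*}

/-- The squared norm of the component of `f` spanned by the basis vectors labelled by `S`. -/
noncomputable def mass (S : Set ι) (f : Hilb ι) : ℝ := ∑' i, S.indicator (fun i => ‖f i‖ ^ 2) i

theorem summable_norm_sq (f : Hilb ι) : Summable fun i => ‖f i‖ ^ 2 := by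
  simpa using (memℓp_gen_iff (p := 2) (by norm_num)).1 (lp.memℓp f)

theorem norm_sq_eq_tsum (f : Hilb ι) : ‖f‖ ^ 2 = ∑' i, ‖f i‖ ^ 2 := by
  simpa using lp.norm_rpow_eq_tsum (p := 2) (by norm_num) f

theorem mass_add_mass_compl (S : Set ι) (f : Hilb ι) : mass S f + mass Sᶜ f = ‖f‖ ^ 2 := by
  rw [mass, mass, norm_sq_eq_tsum, ← ((summable_norm_sq f).indicator S).tsum_add
    ((summable_norm_sq f).indicator Sᶜ)]
  exact tsum_congr fun i => Set.indicator_self_add_compl_apply S _ i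

theorem mass_mono {S S' : Set ι} (h : S ⊆ S') (f : Hilb ι) : mass S f ≤ mass S' f :=
  ((summable_norm_sq f).indicator S).tsum_le_tsum
    (fun i => Set.indicator_le_indicator_of_subset h (fun _ => by positivity) i)
    ((summable_norm_sq f).indicator S')

/-- The orthogonal projection of `f` to the span of the basis vectors labelled by `S`. -/
noncomputable def restrict (S : Set ι) (f : Hilb ι) : Hilb ι :=
  ⟨S.indicator f, by
    refine (memℓp_gen_iff (p := 2) (by norm_num)).2 ?_
    refine ((summable_norm_sq f).indicator S).congr fun i => ?_
    by_cases hi : i ∈ S <;> simp [hi]⟩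

theorem restrict_apply (S : Set ι) (f : Hilb ι) (i : ι) : restrict S f i = S.indicator f i := rfl

theorem norm_restrict_sq (S : Set ι) (f : Hilb ι) : ‖restrict S f‖ ^ 2 = mass S f := by
  rw [norm_sq_eq_tsum, mass]
  refine tsum_congr fun i => ?_
  by_cases hi : i ∈ S <;> simp [restrict_apply, hi]

theorem restrict_sub (S : Set ι) (f g : Hilb ι) :
    restrict S (f - g) = restrict S f - restrict S g := by
  ext i
  simp only [lp.coeFn_sub, Pi.sub_apply, restrict_apply]
  by_cases hi : i ∈ S <;> simp [hi]

/-- Reverse triangle inequality for the projections to `S`. -/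
theorem sq_sqrt_mass_sub_le (S : Set ι) (f g : Hilb ι) :
    (√(mass S f) - √(mass S g)) ^ 2 ≤ mass S (f - g) := by
  rw [← norm_restrict_sq, ← norm_restrict_sq, ← norm_restrict_sq, restrict_sub,
    Real.sqrt_sq (norm_nonneg _), Real.sqrt_sq (norm_nonneg _), ← sq_abs]
  exact pow_le_pow_left₀ (abs_nonneg _) (abs_norm_sub_norm_le _ _) 2

theorem permUnitary_apply (e : ι ≃ ι) (f : Hilb ι) (i : ι) :
    permUnitary e f i = f (e.symm i) := rfl

theorem mass_permUnitary (e : ι ≃ ι) (S : Set ι) (f : Hilb ι) :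
    mass S (permUnitary e f) = mass (e ⁻¹' S) f := by
  rw [mass, mass, ← Equiv.tsum_eq e]
  refine tsum_congr fun i => ?_
  by_cases hi : e i ∈ S <;> simp [permUnitary_apply, hi]

theorem norm_sub_sq_le_of_eqOn_compl {S : Set ι} {f g : Hilb ι} (h : ∀ i ∉ S, f i = g i) :
    ‖f - g‖ ^ 2 ≤ 2 * mass S f + 2 * mass S g := by
  have hf := ((summable_norm_sq f).indicator S).mul_left 2
  have hg := ((summable_norm_sq g).indicator S).mul_left 2
  rw [norm_sq_eq_tsum, mass, mass, ← tsum_mul_left, ← tsum_mul_left, ← hf.tsum_add hg]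
  refine (summable_norm_sq _).tsum_le_tsum (fun i => ?_) (hf.add hg)
  by_cases hi : i ∈ S
  · have h₁ : ‖f i - g i‖ ^ 2 ≤ (‖f i‖ + ‖g i‖) ^ 2 :=
      pow_le_pow_left₀ (norm_nonneg _) (norm_sub_le _ _) 2
    simp only [lp.coeFn_sub, Pi.sub_apply, Set.indicator_of_mem hi]
    nlinarith [sq_nonneg (‖f i‖ - ‖g i‖)]
  · simp [hi, h i hi]

/-- If every basis vector lies in at most `c` of the sets `S y`, the masses of `f` on these sets
add up to at most `c * ‖f‖ ^ 2`. -/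
theorem sum_mass_le {κ : Type*} (Z : Finset κ) (S : κ → Set ι) (f : Hilb ι) (c : ℝ)
    (h : ∀ i, ∑ y ∈ Z, (S y).indicator (1 : ι → ℝ) i ≤ c) :
    ∑ y ∈ Z, mass (S y) f ≤ c * ‖f‖ ^ 2 := by
  simp only [mass]
  rw [norm_sq_eq_tsum, ← tsum_mul_left,
    ← Summable.tsum_finsetSum fun y _ => (summable_norm_sq f).indicator (S y)]
  refine (summable_sum fun y _ => (summable_norm_sq f).indicator (S y)).tsum_le_tsum
    (fun i => ?_) ((summable_norm_sq f).mul_left c)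
  calc ∑ y ∈ Z, (S y).indicator (fun i => ‖f i‖ ^ 2) i
      = (∑ y ∈ Z, (S y).indicator (1 : ι → ℝ) i) * ‖f i‖ ^ 2 := by
        rw [Finset.sum_mul]
        refine Finset.sum_congr rfl fun y _ => ?_
        by_cases hi : i ∈ S y <;> simp [hi]
    _ ≤ c * ‖f i‖ ^ 2 := mul_le_mul_of_nonneg_right (h i) (by positivity)

theorem norm_ket (b : ι) : ‖ket b‖ = 1 := by
  simp [ket]

end HilbertSpace

/-! ### The constant `C_ε` and distinguishable states. -/

theorem adversaryConst_pos {ε : ℝ} (hε : ε < 1 / 2) : 0 < adversaryConst ε := by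
  have : √(ε * (1 - ε)) < 1 / 2 := by
    rw [Real.sqrt_lt' (by norm_num)]
    nlinarith [mul_pos (sub_pos.2 hε) (sub_pos.2 hε)]
  unfold adversaryConst
  linarith

/-- The argument yields a bound linear in `C_ε`; this weakens it to the square. -/
theorem adversaryConst_sq_le {ε : ℝ} (hε : ε < 1 / 2) :
    adversaryConst ε ^ 2 ≤ adversaryConst ε := by
  have h₀ := adversaryConst_pos hε
  have h₁ : adversaryConst ε ≤ 1 := by
    unfold adversaryConst
    linarith [Real.sqrt_nonneg (ε * (1 - ε))]
  nlinarith

/-- Unit vectors that are told apart by a measurement with error at most `ε` are far apart. -/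
theorem adversaryConst_le_norm_sub_sq {ι : Type*} {ε : ℝ} (hε₀ : 0 ≤ ε) (hε : ε < 1 / 2)
    {f g : Hilb ι} (hf : ‖f‖ = 1) (hg : ‖g‖ = 1) {S S' : Set ι} (hS : Disjoint S S')
    (hfS : 1 - ε ≤ mass S f) (hgS : 1 - ε ≤ mass S' g) :
    4 * adversaryConst ε ≤ ‖f - g‖ ^ 2 := by
  have hf' := mass_add_mass_compl S f
  have hg' := mass_add_mass_compl S g
  rw [hf] at hf'
  rw [hg] at hg'
  have hgc : 1 - ε ≤ mass Sᶜ g := hgS.trans (mass_mono hS.subset_compl_left g)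
  have h₀ : √ε ≤ √(1 - ε) := Real.sqrt_le_sqrt (by linarith)
  have h₁ : √(1 - ε) ≤ √(mass S f) := Real.sqrt_le_sqrt hfS
  have h₂ : √(1 - ε) ≤ √(mass Sᶜ g) := Real.sqrt_le_sqrt hgc
  have h₃ : √(mass S g) ≤ √ε := Real.sqrt_le_sqrt (by linarith)
  have h₄ : √(mass Sᶜ f) ≤ √ε := Real.sqrt_le_sqrt (by linarith)
  have key : 2 * adversaryConst ε = (√(1 - ε) - √ε) ^ 2 := by
    rw [adversaryConst, Real.sqrt_mul hε₀, sub_sq, Real.sq_sqrt hε₀,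
      Real.sq_sqrt (by linarith)]
    ring
  -- On `S` the vector `f` is heavy and `g` light, on `Sᶜ` conversely; each part contributes `2 *
  -- C_ε`.
  have h₅ : (√(1 - ε) - √ε) ^ 2 ≤ (√(mass S f) - √(mass S g)) ^ 2 :=
    pow_le_pow_left₀ (by linarith) (by linarith) 2
  have h₆ : (√(1 - ε) - √ε) ^ 2 ≤ (√(mass Sᶜ g) - √(mass Sᶜ f)) ^ 2 :=
    pow_le_pow_left₀ (by linarith) (by linarith) 2
  rw [sub_sq_comm (√(mass Sᶜ g))] at h₆
  have h₇ := sq_sqrt_mass_sub_le S f g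
  have h₈ := sq_sqrt_mass_sub_le Sᶜ f g
  rw [← mass_add_mass_compl S (f - g)]
  linarith

/-! ### Oracle calls and the adversary argument. -/

section Queries

variable {Γ A S' : Type*} [AddGroup A] {T d : ℕ}

/-- The basis states whose queries distinguish the black boxes `x` and `y`. -/
def distinguishing (T d : ℕ) (x y : Γ → A) : Set (Basis Γ A T d) :=
  {b | ∃ k, x (b.1 k) ≠ y (b.1 k)}

theorem norm_oracle_sub_sq_le (x y : Γ → A) (f : Hilb (Basis Γ A T d)) :
    ‖oracle T d x f - oracle T d y f‖ ^ 2 ≤ 4 * mass (distinguishing T d x y) f := by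
  have h := norm_sub_sq_le_of_eqOn_compl (S := distinguishing T d x y)
    (f := oracle T d x f) (g := oracle T d y f) fun b hb => by
      have hb' : ∀ k, x (b.1 k) = y (b.1 k) := by simpa [distinguishing] using hb
      simp [oracle, permUnitary_apply, oraclePerm, hb']
  rw [oracle, oracle, mass_permUnitary, mass_permUnitary] at h
  -- The oracle changes only the answer registers, whereas `distinguishing` looks only at the query
  -- registers.
  have hpre (z : Γ → A) : oraclePerm T d z ⁻¹' distinguishing T d x y = distinguishing T d x y :=
    rfl
  rw [hpre, hpre] at h
  rw [oracle, oracle]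
  linarith

namespace Algorithm

theorem outcomeProb_eq_mass (alg : Algorithm Γ A S' T) (x : Γ → A) (s : S') :
    alg.outcomeProb x s = mass {b | alg.out b = s} (alg.finalState x) :=
  tsum_subtype {b | alg.out b = s} fun b => ‖alg.finalState x b‖ ^ 2

theorem norm_finalState (alg : Algorithm Γ A S' T) (x : Γ → A) : ‖alg.finalState x‖ = 1 := by
  simp [finalState, norm_ket]

/-- `V` preserves distances, so the gap `4 * C_ε` between the final states is already present after
the oracle calls, which move a common state apart by at most four times this mass. -/
theorem Computes.adversaryConst_le_mass {ε : ℝ} (hε₀ : 0 ≤ ε) (hε : ε < 1 / 2)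
    {alg : Algorithm Γ A S' T} {F : (Γ → A) →. S'} (h : alg.Computes F ε)
    {x y : Γ → A} {s t : S'} (hs : s ∈ F x) (ht : t ∈ F y) (hst : s ≠ t) :
    adversaryConst ε ≤ mass (distinguishing T alg.work x y) (alg.U (ket alg.start)) := by
  have hx := h x s hs
  have hy := h y t ht
  rw [outcomeProb_eq_mass] at hx hy
  have h₁ := adversaryConst_le_norm_sub_sq hε₀ hε (alg.norm_finalState x) (alg.norm_finalState y)
    (Set.disjoint_left.2 fun b (hb : alg.out b = s) (hb' : alg.out b = t) =>
      hst (hb.symm.trans hb')) hx hy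
  rw [finalState, finalState, ← map_sub, LinearIsometryEquiv.norm_map] at h₁
  linarith [norm_oracle_sub_sq_le x y (alg.U (ket alg.start))]

/-- The adversary bound at a single black box `x`. -/
theorem Computes.adversaryConst_mul_card_le {ε : ℝ} (hε₀ : 0 ≤ ε) (hε : ε < 1 / 2)
    {alg : Algorithm Γ A S' T} {F : (Γ → A) →. S'} (h : alg.Computes F ε)
    {x : Γ → A} {s t : S'} (hs : s ∈ F x) (hst : s ≠ t) (Z : Finset (Γ → A))
    (hZ : ∀ y ∈ Z, t ∈ F y) (l : ℕ) (hl : ∀ i, {y ∈ (Z : Set (Γ → A)) | x i ≠ y i}.encard ≤ l) :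
    adversaryConst ε * Z.card ≤ T * l := by
  classical
  have hl' (i : Γ) : (Z.filter fun y => x i ≠ y i).card ≤ l := by
    have h₀ := hl i
    rw [show {y ∈ (Z : Set (Γ → A)) | x i ≠ y i} = (Z.filter fun y => x i ≠ y i : Finset _) by
      ext; simp, Set.encard_coe_eq_coe_finsetCard] at h₀
    exact_mod_cast h₀
  have h₁ := sum_mass_le Z (distinguishing T alg.work x) (alg.U (ket alg.start)) (T * l)
    fun b => by
      calc ∑ y ∈ Z, (distinguishing T alg.work x y).indicator (1 : Basis Γ A T alg.work → ℝ) b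
          ≤ ∑ y ∈ Z, ∑ k : Fin T, if x (b.1 k) ≠ y (b.1 k) then (1 : ℝ) else 0 := by
            refine Finset.sum_le_sum fun y _ => ?_
            refine Set.indicator_apply_le' (fun ⟨k, hk⟩ => ?_) fun _ =>
              Finset.sum_nonneg fun k _ => by split_ifs <;> norm_num
            refine le_trans ?_ (Finset.single_le_sum (fun k _ => ?_) (Finset.mem_univ k))
            · simp [hk]
            · split_ifs <;> norm_num
        _ = ∑ k : Fin T, ((Z.filter fun y => x (b.1 k) ≠ y (b.1 k)).card : ℝ) := by
            rw [Finset.sum_comm]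
            exact Finset.sum_congr rfl fun k _ => by rw [Finset.sum_boole]
        _ ≤ ∑ _k : Fin T, (l : ℝ) :=
            Finset.sum_le_sum fun k _ => by exact_mod_cast hl' (b.1 k)
        _ = T * l := by simp
  rw [LinearIsometryEquiv.norm_map, norm_ket, one_pow, mul_one] at h₁
  refine le_trans ?_ h₁
  rw [mul_comm, ← nsmul_eq_mul]
  exact Finset.card_nsmul_le_sum _ _ _ fun y hy => h.adversaryConst_le_mass hε₀ hε hs (hZ y hy) hst

/-- The adversary bound at a single black box `x`, for a possibly infinite set of adversaries. -/
theorem Computes.adversaryConst_sq_mul_div_le {ε : ℝ} (hε₀ : 0 ≤ ε) (hε : ε < 1 / 2)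
    {alg : Algorithm Γ A S' T} {F : (Γ → A) →. S'} (h : alg.Computes F ε)
    {x : Γ → A} {s t : S'} (hs : s ∈ F x) (hst : s ≠ t) (Y : Set (Γ → A))
    (hY : ∀ y ∈ Y, t ∈ F y) (m l : ℕ) (hm : (m : ℕ∞) ≤ Y.encard)
    (hl : ∀ i, {y ∈ Y | x i ≠ y i}.encard ≤ l) :
    adversaryConst ε ^ 2 * ((m : ℝ) / l) ≤ T := by
  -- Exactly `m` adversaries are kept, so that the sum is finite; the bounds by `l` survive.
  obtain ⟨W, hWY, hW⟩ := Set.exists_subset_encard_eq hm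
  obtain ⟨Z, rfl⟩ := (Set.finite_of_encard_eq_coe hW).exists_finset_coe
  have hcard : Z.card = m := by rw [Set.encard_coe_eq_coe_finsetCard] at hW; exact_mod_cast hW
  have h₁ := h.adversaryConst_mul_card_le hε₀ hε hs hst Z (fun y hy => hY y (hWY hy)) l
    fun i => (Set.encard_le_encard (Set.inter_subset_inter_left _ hWY)).trans (hl i)
  rw [hcard] at h₁
  -- For `l = 0` the quotient is `0` by convention.
  rcases Nat.eq_zero_or_pos l with rfl | hl₀
  · simp
  · rw [← mul_div_assoc, div_le_iff₀ (by exact_mod_cast hl₀)]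
    exact (mul_le_mul_of_nonneg_right (adversaryConst_sq_le hε) (Nat.cast_nonneg m)).trans h₁

/-- The adversary bound for black boxes that each differ from `x` at a single, different place. -/
theorem Computes.adversaryConst_sq_mul_le {ε : ℝ} (hε₀ : 0 ≤ ε) (hε : ε < 1 / 2) {N : ℕ}
    {alg : Algorithm (Fin N) A S' T} {F : (Fin N → A) →. S'} (h : alg.Computes F ε)
    {x : Fin N → A} {s t : S'} (hs : s ∈ F x) (hst : s ≠ t) (a : Fin N → A)
    (ha : ∀ i, a i ≠ x i) (hF : ∀ i, t ∈ F (Function.update x i (a i))) :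
    adversaryConst ε ^ 2 * N ≤ T := by
  have hne {i j : Fin N} (hij : x i ≠ Function.update x j (a j) i) : i = j := by
    by_contra hc
    exact hij (Function.update_of_ne hc _ _).symm
  have hinj : Function.Injective fun i => Function.update x i (a i) := fun i j hij => by
    refine hne ?_
    have hi := congrFun hij i
    simp only [Function.update_self] at hi
    exact hi ▸ (ha i).symm
  have := h.adversaryConst_sq_mul_div_le hε₀ hε hs hst
    (Set.range fun i => Function.update x i (a i)) (by rintro _ ⟨i, rfl⟩; exact hF i) N 1
    (by rw [← Set.image_univ, hinj.encard_image]; simp) fun i => by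
      rw [Nat.cast_one, Set.encard_le_one_iff]
      rintro _ _ ⟨⟨j, rfl⟩, hj⟩ ⟨⟨k, rfl⟩, hk⟩
      rw [← hne hj, ← hne hk]
  simpa using this

end Algorithm

theorem ofReal_le_queryComplexity {ε r : ℝ} {F : (Γ → A) →. S'}
    (h : ∀ (T : ℕ) (alg : Algorithm Γ A S' T), alg.Computes F ε → r ≤ T) :
    ENNReal.ofReal r ≤ (queryComplexity ε F : ℝ≥0∞) := by
  have h₁ : ((⌈r⌉₊ : ℕ) : ℕ∞) ≤ queryComplexity ε F :=
    le_iInf₂ fun T ⟨alg, halg⟩ => by exact_mod_cast Nat.ceil_le.2 (h T alg halg)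
  calc ENNReal.ofReal r ≤ ENNReal.ofReal (⌈r⌉₊ : ℕ) := ENNReal.ofReal_le_ofReal (Nat.le_ceil r)
    _ = (((⌈r⌉₊ : ℕ) : ℕ∞) : ℝ≥0∞) := by simp
    _ ≤ _ := ENat.toENNReal_le.2 h₁

end Queries

end NonadaptiveQuery

theorem mainTheorem2 (ε : ℝ) (hε₀ : 0 ≤ ε) (hε : ε < 1 / 2) :
    -- the adversary bound
    (∀ (Γ : Type*) [Finite Γ] (A : Type*) [AddGroup A] (F : (Γ → A) →. Fin 2)
        (X Y : Set (Γ → A)) (R : Set ((Γ → A) × (Γ → A))) (m m' l l' : ℕ),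
      X.Nonempty → Y.Nonempty →
      X ⊆ {x | 0 ∈ F x} → Y ⊆ {y | 1 ∈ F y} → R ⊆ X ×ˢ Y →
      (∀ x ∈ X, (m : ℕ∞) ≤ {y ∈ Y | (x, y) ∈ R}.encard) →
      (∀ y ∈ Y, (m' : ℕ∞) ≤ {x ∈ X | (x, y) ∈ R}.encard) →
      (∀ x ∈ X, ∀ i : Γ, {y ∈ Y | (x, y) ∈ R ∧ x i ≠ y i}.encard ≤ (l : ℕ∞)) →
      (∀ y ∈ Y, ∀ i : Γ, {x ∈ X | (x, y) ∈ R ∧ x i ≠ y i}.encard ≤ (l' : ℕ∞)) →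
      ENNReal.ofReal (NonadaptiveQuery.adversaryConst ε ^ 2 *
          max ((m : ℝ) / (l : ℝ)) ((m' : ℝ) / (l' : ℝ)))
        ≤ (NonadaptiveQuery.queryComplexity ε F : ℝ≥0∞)) ∧
    -- linear lower bounds for Unordered Search and Element Distinctness
    0 < NonadaptiveQuery.adversaryConst ε ∧
    (∀ N : ℕ,
      ENNReal.ofReal (NonadaptiveQuery.adversaryConst ε ^ 2 * (N : ℝ))
        ≤ (NonadaptiveQuery.queryComplexity ε
            (NonadaptiveQuery.unorderedSearch N : (Fin N → ZMod 2) →. Fin 2) : ℝ≥0∞)) ∧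
    (∀ (N : ℕ) (A : Type*) [AddGroup A] (D : Set A), 2 ≤ N → D.encard = (N : ℕ∞) →
      ENNReal.ofReal (NonadaptiveQuery.adversaryConst ε ^ 2 * (N : ℝ))
        ≤ (NonadaptiveQuery.queryComplexity ε
            (NonadaptiveQuery.elementDistinctness N D) : ℝ≥0∞)) := by
  refine ⟨?_, NonadaptiveQuery.adversaryConst_pos hε, ?_, ?_⟩
  · intro Γ _ A _ F X Y R m m' l l' hX hY hXF hYF _ hm hm' hl hl'
    refine NonadaptiveQuery.ofReal_le_queryComplexity fun T alg halg => ?_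
    obtain ⟨x, hx⟩ := hX
    obtain ⟨y, hy⟩ := hY
    rw [mul_max_of_nonneg _ _ (sq_nonneg _)]
    refine max_le ?_ ?_
    · exact halg.adversaryConst_sq_mul_div_le hε₀ hε (hXF hx) zero_ne_one _
        (fun z hz => hYF hz.1) m l (hm x hx) fun i => by
          simpa only [Set.mem_ofPred_eq, and_assoc] using hl x hx i
    · exact halg.adversaryConst_sq_mul_div_le hε₀ hε (hYF hy) one_ne_zero _
        (fun z hz => hXF hz.1) m' l' (hm' y hy) fun i => by
          simpa only [Set.mem_ofPred_eq, and_assoc, ne_comm] using hl' y hy i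
  · intro N
    refine NonadaptiveQuery.ofReal_le_queryComplexity fun T alg halg => ?_
    -- The zero input against the `N` inputs with a single one.
    refine halg.adversaryConst_sq_mul_le hε₀ hε (x := 0) (s := 0) (t := 1) ?_ zero_ne_one 1
      (fun i => by simp) fun i => ?_
    · simp [NonadaptiveQuery.unorderedSearch]
    · have : ∃ j, Function.update (0 : Fin N → ZMod 2) i ((1 : Fin N → ZMod 2) i) j = 1 :=
        ⟨i, by simp⟩
      simp only [PFun.coe_val, Part.mem_some_iff, NonadaptiveQuery.unorderedSearch, if_pos this]
  · intro N A _ D hN hD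
    refine NonadaptiveQuery.ofReal_le_queryComplexity fun T alg halg => ?_
    have : Nontrivial (Fin N) := Fin.nontrivial_iff_two_le.2 hN
    obtain ⟨Z, rfl⟩ := (Set.finite_of_encard_eq_coe hD).exists_finset_coe
    have hcard : Z.card = N := by
      rw [Set.encard_coe_eq_coe_finsetCard] at hD
      exact_mod_cast hD
    let e := (Z.equivFinOfCardEq hcard).symm
    have hinj : Function.Injective fun i => (e i : A) :=
      Subtype.val_injective.comp e.injective
    -- Overwriting the value at `i` by the one at `σ i ≠ i` creates a collision within `D`; this
    -- needs `2 ≤ N`.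
    choose σ hσ using fun i : Fin N => exists_ne i
    refine halg.adversaryConst_sq_mul_le hε₀ hε (x := fun i => (e i : A)) (s := 0) (t := 1)
      ?_ zero_ne_one (fun i => (e (σ i) : A)) (fun i => hinj.ne (hσ i)) fun i => ?_
    · exact ⟨fun i => (e i).2, if_pos hinj⟩
    · refine ⟨fun j => ?_, if_neg fun hc => hσ i (hc ?_)⟩
      · rcases eq_or_ne j i with rfl | hj
        · simp
        · simp [Function.update_of_ne hj]
      · simp [Function.update_of_ne (hσ i)]
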